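/- Let $\Gamma$ be a group of isometries of hyperbolic space $\mathbb H^3$ acting freely and properly discontinuously, and let $x\in\mathbb H^3$. The Dirichlet domain of $\Gamma$ centred at $x$ is $D=D_x(\Gamma)=\{y\in\mathbb H^3 : d(x,y)\le d(gx,y)\ \text{for all } g\in\Gamma\setminus\{1\}\}$; assume that $M=\mathbb H^3/\Gamma$ has finite volume, i.e. $\mathrm{vol}(D)<\infty$. The injectivity radius of $D$ is the radius of the largest ball centred at $x$ and contained in $D$. For $g\in\Gamma$ put $H_g=\{y : d(x,y)\le d(gx,y)\}$. An element $g\ne 1$ of $\Gamma$ is a face-pairing of a polyhedron $P$ centred at $x$ if $P\subseteq H_g$ and $P$ meets the plane $\{y : d(x,y)=d(gx,y)\}$ in a set with non-empty interior in that plane (a face of $P$). An approximate Dirichlet domain of $\Gamma$ centred at $x$ is a finite intersection $D'=\bigcap_{g\in S}H_g$, $S\subset\Gamma$ finite, such that $\Gamma$ has a generating set all of whose elements and their inverses are face-pairings of $D'$. Let $C'$ be the Cayley graph with vertex set $\Gamma$ in which two distinct elements $h,h'$ are adjacent if $h'=hg$ or $h=h'g$ for some face-pairing $g$ of $D'$.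 Claim: for all $R>0$ and $\rho>0$ there is $\varepsilon=\varepsilon(R,\rho)>0$ such that, for every $\Gamma$ and $x$ as above for which the injectivity radius of $D$ is at least $\rho$, and for every approximate Dirichlet domain $D'$ of $\Gamma$ centred at $x$ with $\Delta V=\mathrm{vol}(D')-\mathrm{vol}(D)<\varepsilon$, the graph $C'$ is connected inside the ball $B(x,R)$: the full subgraph of $C'$ on the vertices $\{g\in\Gamma : d(x,gx)<R\}$ is connected. (This holds for every basepoint $x$, in particular for one that minimizes the spine radius of $D'$.) -/

import Mathlib

open scoped ENNReal

noncomputable section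

/-- Hyperbolic `3`-space, in the upper half-space model `{(z, t) : z ∈ ℂ, t > 0}`. -/
@[ext]
structure Hyp3 where
  z : ℂ
  t : ℝ
  t_pos : 0 < t

namespace Hyp3

/-- The underlying point of `ℂ × ℝ`. -/
def coords (p : Hyp3) : ℂ × ℝ := (p.z, p.t)

/-- The underlying point of Euclidean `3`-space `ℂ × ℝ` (with the Euclidean norm). -/
def toEuclidean (p : Hyp3) : WithLp 2 (ℂ × ℝ) := WithLp.toLp 2 (p.z, p.t)

/-- The mirror image of a point in the boundary plane `t = 0`. -/
def mirror (p : Hyp3) : WithLp 2 (ℂ × ℝ) := WithLp.toLp 2 (p.z, -p.t)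

/-- The hyperbolic distance, `sinh (d (p, q) / 2) = |p - q| / (2 √(t_p t_q))`
with `|p - q|` the Euclidean distance. -/
instance : Dist Hyp3 :=
  ⟨fun p q => 2 * Real.arsinh (dist p.toEuclidean q.toEuclidean / (2 * √(p.t * q.t)))⟩

theorem dist_eq (p q : Hyp3) :
    dist p q = 2 * Real.arsinh (dist p.toEuclidean q.toEuclidean / (2 * √(p.t * q.t))) :=
  rfl

theorem toEuclidean_dist_sq (p q : Hyp3) :
    dist p.toEuclidean q.toEuclidean ^ 2 = ‖p.z - q.z‖ ^ 2 + (p.t - q.t) ^ 2 := by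
  rw [dist_eq_norm, WithLp.prod_norm_sq_eq_of_L2]
  simp [toEuclidean]

theorem toEuclidean_dist_mirror_sq (p q : Hyp3) :
    dist p.toEuclidean q.mirror ^ 2 = ‖p.z - q.z‖ ^ 2 + (p.t + q.t) ^ 2 := by
  rw [dist_eq_norm, WithLp.prod_norm_sq_eq_of_L2]
  simp [toEuclidean, mirror]

theorem toEuclidean_injective : Function.Injective toEuclidean := by
  intro p q h
  have h' : (p.z, p.t) = (q.z, q.t) := by
    simpa [toEuclidean] using congrArg WithLp.ofLp h
  exact Hyp3.ext (congrArg Prod.fst h') (congrArg Prod.snd h')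

theorem sinh_half_dist (p q : Hyp3) :
    Real.sinh (dist p q / 2) = dist p.toEuclidean q.toEuclidean / (2 * √(p.t * q.t)) := by
  rw [dist_eq, mul_div_cancel_left₀ (Real.arsinh _) two_ne_zero, Real.sinh_arsinh]

theorem cosh_half_dist (p q : Hyp3) :
    Real.cosh (dist p q / 2) = dist p.toEuclidean q.mirror / (2 * √(p.t * q.t)) := by
  have hp := p.t_pos
  have hq := q.t_pos
  rw [← sq_eq_sq₀ (by positivity) (by positivity), Real.cosh_sq', sinh_half_dist, div_pow, div_pow,
    toEuclidean_dist_sq, toEuclidean_dist_mirror_sq, mul_pow, Real.sq_sqrt (by positivity)]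
  field_simp
  ring

/-- `cosh d(p, q) = 1 + |p - q|² / (2 t_p t_q)`. -/
theorem cosh_dist (p q : Hyp3) :
    Real.cosh (dist p q) = 1 + (‖p.z - q.z‖ ^ 2 + (p.t - q.t) ^ 2) / (2 * p.t * q.t) := by
  have hp := p.t_pos
  have hq := q.t_pos
  have h : dist p q = 2 * (dist p q / 2) := by ring
  rw [h, Real.cosh_two_mul, Real.cosh_sq', sinh_half_dist, div_pow, mul_pow,
    toEuclidean_dist_sq, Real.sq_sqrt (by positivity)]
  field_simp
  ring

protected theorem dist_comm (p q : Hyp3) : dist p q = dist q p := by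
  simp only [dist_eq, dist_comm p.toEuclidean, mul_comm p.t]

protected theorem dist_triangle (a b c : Hyp3) : dist a c ≤ dist a b + dist b c := by
  have ha := a.t_pos
  have hb := b.t_pos
  have hc := c.t_pos
  have hbb : dist b.toEuclidean b.mirror = 2 * b.t := by
    rw [← sq_eq_sq₀ (by positivity) (by positivity), toEuclidean_dist_mirror_sq]
    simp
    ring
  have hcb : dist b.toEuclidean c.mirror = dist c.toEuclidean b.mirror := by
    rw [← sq_eq_sq₀ (by positivity) (by positivity), toEuclidean_dist_mirror_sq,
      toEuclidean_dist_mirror_sq, norm_sub_rev, add_comm b.t]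
  have key := EuclideanGeometry.mul_dist_le_mul_dist_add_mul_dist
    a.toEuclidean b.toEuclidean c.toEuclidean b.mirror
  rw [hbb] at key
  have h : Real.sinh (dist a c / 2) ≤ Real.sinh (dist a b / 2 + dist b c / 2) := by
    rw [Real.sinh_add, sinh_half_dist, sinh_half_dist, sinh_half_dist, cosh_half_dist,
      cosh_half_dist, hcb, Real.sqrt_mul ha.le, Real.sqrt_mul ha.le, Real.sqrt_mul hb.le]
    have sa : 0 < √a.t := Real.sqrt_pos.2 ha
    have sb : 0 < √b.t := Real.sqrt_pos.2 hb
    have sc : 0 < √c.t := Real.sqrt_pos.2 hc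
    have hb2 : b.t = √b.t * √b.t := (Real.mul_self_sqrt hb.le).symm
    rw [div_mul_div_comm, div_mul_div_comm, ← add_div, div_le_div_iff₀ (by positivity)
      (by positivity)]
    have key' := mul_le_mul_of_nonneg_left key (by positivity : 0 ≤ 2 * (√a.t * √c.t))
    rw [hb2] at key'
    nlinarith [key']
  have := Real.sinh_le_sinh.1 h
  linarith

instance : MetricSpace Hyp3 where
  dist_self p := by rw [dist_eq, dist_self, zero_div, Real.arsinh_zero, mul_zero]
  dist_comm := Hyp3.dist_comm
  dist_triangle := Hyp3.dist_triangle
  eq_of_dist_eq_zero {p q} h := by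
    have hs : √(p.t * q.t) ≠ 0 := (Real.sqrt_pos.2 (mul_pos p.t_pos q.t_pos)).ne'
    rw [dist_eq] at h
    apply toEuclidean_injective
    simpa [hs] using h

/-- The hyperbolic volume `∫_A dx dy dt / t³`. -/
def hypVolume (A : Set Hyp3) : ℝ≥0∞ :=
  ∫⁻ p in coords '' A, ENNReal.ofReal (1 / p.2 ^ 3)

/-- The half-space of the points at least as close to `x` as to `y`. -/
def halfSpace (x y : Hyp3) : Set Hyp3 := {w | dist x w ≤ dist y w}

/-- The plane of the points equidistant from `x` and `y`. -/
def bisector (x y : Hyp3) : Set Hyp3 := {w | dist x w = dist y w}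

/-- `Γ` acts freely and properly discontinuously on `ℍ³`, i.e. `ℍ³ / Γ` is a (complete)
hyperbolic `3`-manifold with fundamental group `Γ`. -/
structure IsManifoldGroup (Γ : Subgroup (Hyp3 ≃ᵢ Hyp3)) : Prop where
  free : ∀ g ∈ Γ, ∀ p : Hyp3, g p = p → g = 1
  properlyDiscontinuous : ∀ K : Set Hyp3, IsCompact K → {g ∈ Γ | (g '' K ∩ K).Nonempty}.Finite

/-- The Dirichlet domain of `Γ` with basepoint `x`. -/
def dirichletDomain (Γ : Subgroup (Hyp3 ≃ᵢ Hyp3)) (x : Hyp3) : Set Hyp3 :=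
  {w | ∀ g ∈ Γ, g ≠ 1 → dist x w ≤ dist (g x) w}

/-- The elements `g ≠ 1` of `Γ` that correspond to the faces of a polyhedron `P` centred at `x`:
`P` lies on the side of `x` of the bisector of `x` and `g x`, and meets this bisector in a set
with non-empty interior relative to the bisector. -/
def facePairings (Γ : Subgroup (Hyp3 ≃ᵢ Hyp3)) (x : Hyp3) (P : Set Hyp3) : Set Γ :=
  {g | g ≠ 1 ∧ P ⊆ halfSpace x (g.1 x) ∧
    ∃ w ∈ bisector x (g.1 x), ∃ δ > 0, Metric.ball w δ ∩ bisector x (g.1 x) ⊆ P}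

/-- `P` is an approximate Dirichlet domain of `Γ` centred at `x`: a finite intersection of
half-spaces `{w | d(x, w) ≤ d(g x, w)}`, `g ∈ Γ`, such that the elements of some generating set of
`Γ` and their inverses all correspond to faces of `P`. -/
def IsApproxDirichletDomain (Γ : Subgroup (Hyp3 ≃ᵢ Hyp3)) (x : Hyp3) (P : Set Hyp3) : Prop :=
  (∃ S : Finset Γ, P = ⋂ g ∈ S, halfSpace x (g.1 x)) ∧
    ∃ G : Set Γ, Subgroup.closure G = ⊤ ∧
      ∀ g ∈ G, g ∈ facePairings Γ x P ∧ g⁻¹ ∈ facePairings Γ x P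

/-- The Cayley graph of `Γ` whose generators are the face-pairings of `P`: the vertices are the
elements of `Γ`, and `h`, `h'` are joined when `h' = h g` or `h = h' g` for a generator `g`. -/
def cayleyGraph (Γ : Subgroup (Hyp3 ≃ᵢ Hyp3)) (x : Hyp3) (P : Set Hyp3) : SimpleGraph Γ :=
  SimpleGraph.mulCayley (facePairings Γ x P)

/-- A graph on `Γ` is connected inside the ball `B(x, R)`: its full subgraph on the vertices `g`
with `g x ∈ B(x, R)` is connected. -/
def ConnectedInBall {Γ : Subgroup (Hyp3 ≃ᵢ Hyp3)} (C : SimpleGraph Γ) (x : Hyp3) (R : ℝ) : Prop :=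
  (C.induce {g : Γ | g.1 x ∈ Metric.ball x R}).Connected

end Hyp3

end

open Set Metric

namespace Hyp3

/-! If every orbit point `g x ≠ x` with `d(x, g x) < R` lies outside `D'`, then some face-pairing
`f` has `d(f x, g⁻¹ x) < d(x, g⁻¹ x)`, that is, `d(g f x, x) < d(g x, x)`. So `g` has a neighbour `g
f` closer to the identity, still in the ball, and descent through the finitely many vertices reaches
`1` (`connectedInBall_cayleyGraph`). The volume hypothesis keeps orbit points out of `D'`
(`exists_volume_gap`). If `y = g x` were in `D'`, slide it slightly towards `x`. As `x` satisfies
all defining inequalities of `D'` with a margin depending only on `ρ`, a ball of uniform radius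
around the new point lies in `D'` (`exists_radius_ball_subset`). That ball is within `ρ / 2` of `y`,
hence misses `D`, so its volume, bounded below uniformly, is at most `ΔV`. Convexity arguments use
the hyperboloid model, where `cosh d` is minus the Lorentz pairing and hence linear in each point.
-/

/-! ### Convex combinations in the hyperboloid model -/

theorem cosh_dist_eq (p q : Hyp3) :
    Real.cosh (dist p q) = (‖p.z - q.z‖ ^ 2 + p.t ^ 2 + q.t ^ 2) / (2 * p.t * q.t) := by
  have hp := p.t_pos
  have hq := q.t_pos
  rw [cosh_dist]
  field_simp
  ring

theorem dist_lt_iff_cosh {a b c d : Hyp3} :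
    dist a b < dist c d ↔ Real.cosh (dist a b) < Real.cosh (dist c d) := by
  rw [Real.cosh_lt_cosh, abs_of_nonneg dist_nonneg, abs_of_nonneg dist_nonneg]

theorem dist_le_iff_cosh {a b c d : Hyp3} :
    dist a b ≤ dist c d ↔ Real.cosh (dist a b) ≤ Real.cosh (dist c d) := by
  rw [Real.cosh_le_cosh, abs_of_nonneg dist_nonneg, abs_of_nonneg dist_nonneg]

theorem cosh_dist_lt_cosh {a b : Hyp3} {r : ℝ} (h : dist a b < r) :
    Real.cosh (dist a b) < Real.cosh r := by
  rw [Real.cosh_lt_cosh, abs_of_nonneg dist_nonneg]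
  exact h.trans_le (le_abs_self r)

/-- The point of hyperbolic space whose hyperboloid coordinates are a given normalized
positive combination of those of `p` and `q`. -/
theorem exists_combination (p q : Hyp3) {a b : ℝ} (ha : 0 < a) (hb : 0 < b)
    (h : a ^ 2 + b ^ 2 + 2 * a * b * Real.cosh (dist p q) = 1) :
    ∃ m : Hyp3, ∀ w : Hyp3, Real.cosh (dist w m) =
      a * Real.cosh (dist w p) + b * Real.cosh (dist w q) := by
  have hp := p.t_pos
  have hq := q.t_pos
  have hn : 0 < a * q.t + b * p.t := by positivity
  -- The hyperboloid vector of `(z, t)` has coordinates `1/t`, `z/t`, `(|z|² + t²)/t`; the first two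
  -- determine the point and are combined with weights `a`, `b`.
  refine ⟨⟨(((a * q.t / (a * q.t + b * p.t) : ℝ) : ℂ) * p.z +
    ((b * p.t / (a * q.t + b * p.t) : ℝ) : ℂ) * q.z), p.t * q.t / (a * q.t + b * p.t),
    by positivity⟩, fun w => ?_⟩
  have hw := w.t_pos
  rw [cosh_dist_eq] at h
  simp only [cosh_dist_eq]
  obtain ⟨⟨p1, p2⟩, s, hs⟩ := p
  obtain ⟨⟨q1, q2⟩, t, ht⟩ := q
  obtain ⟨⟨w1, w2⟩, u, hu⟩ := w
  simp only [← Complex.normSq_eq_norm_sq, Complex.normSq_apply, Complex.sub_re, Complex.sub_im,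
    Complex.add_re, Complex.add_im, Complex.mul_re, Complex.mul_im, Complex.ofReal_re,
    Complex.ofReal_im] at *
  have hN : a * t + b * s ≠ 0 := hn.ne'
  field_simp at h ⊢
  linear_combination -(s * t) * h

theorem exists_proportional_combination (p q : Hyp3) {a b : ℝ} (ha : 0 < a) (hb : 0 < b) :
    ∃ m : Hyp3, ∀ w : Hyp3,
      √(a ^ 2 + b ^ 2 + 2 * a * b * Real.cosh (dist p q)) * Real.cosh (dist w m) =
      a * Real.cosh (dist w p) + b * Real.cosh (dist w q) := by
  have hc := Real.cosh_pos (dist p q)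
  set N := a ^ 2 + b ^ 2 + 2 * a * b * Real.cosh (dist p q) with hN
  have hN0 : 0 < N := by positivity
  have hs : 0 < √N := Real.sqrt_pos.2 hN0
  have hss : √N ^ 2 = N := Real.sq_sqrt hN0.le
  obtain ⟨m, hm⟩ := exists_combination p q (a := a / √N) (b := b / √N) (by positivity)
    (by positivity) (by
      have : (a / √N) ^ 2 + (b / √N) ^ 2 + 2 * (a / √N) * (b / √N) * Real.cosh (dist p q) =
          N / √N ^ 2 := by
        rw [hN]; field_simp
      rw [this, hss, div_self hN0.ne'])
  refine ⟨m, fun w => ?_⟩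
  rw [hm w]
  field_simp

/-! ### Faces of a finite intersection of half-spaces -/

/-- If `w` lies outside a finite intersection of half-spaces centred at `x`, then some
face-pairing of the intersection separates `w` from `x`. -/
theorem exists_facePairing_dist_lt {Γ : Subgroup (Hyp3 ≃ᵢ Hyp3)} {x : Hyp3} {P : Set Hyp3}
    {S : Finset Γ} (hP : P = ⋂ g ∈ S, halfSpace x (g.1 x)) {w : Hyp3} (hw : w ∉ P) :
    ∃ f ∈ facePairings Γ x P, dist (f.1 x) w < dist x w := by
  classical
  -- In an irredundant subfamily `T`, each `f` has a point `p` violating its inequality alone; the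
  -- segment from `x` to `p` then crosses the face of `f`.
  obtain ⟨T, -, hT⟩ := exists_minimal_le_of_wellFoundedLT
    (fun T : Finset Γ => P = ⋂ g ∈ T, halfSpace x (g.1 x)) S hP
  have hPT := hT.prop
  have hess : ∀ f ∈ T, ∃ p, dist (f.1 x) p < dist x p ∧
      ∀ g ∈ T, g ≠ f → dist x p ≤ dist (g.1 x) p := by
    intro f hf
    by_contra! hcon
    refine Finset.notMem_erase f T (hT.le_of_le (y := T.erase f) ?_ (Finset.erase_subset _ _) hf)
    refine hPT.trans (Set.Subset.antisymm ?_ ?_)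
    · exact Set.biInter_subset_biInter_left (fun g hg => Finset.mem_of_mem_erase hg)
    · intro p hp
      simp only [Set.mem_iInter, halfSpace, Set.mem_ofPred_eq, Finset.mem_erase, and_imp] at hp ⊢
      intro g hg
      by_cases hgf : g = f
      · by_contra! hlt
        subst hgf
        obtain ⟨g', hg', hne, hlt'⟩ := hcon p hlt
        exact absurd (hp g' hne hg') hlt'.not_ge
      · exact hp g hgf hg
  have hpos : ∀ g ∈ T, 1 < Real.cosh (dist (g.1 x) x) := by
    intro g hg
    rw [Real.one_lt_cosh, dist_ne_zero]
    intro h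
    obtain ⟨p, hp, -⟩ := hess g hg
    rw [h] at hp
    exact hp.false
  have hwT : ∃ f ∈ T, dist (f.1 x) w < dist x w := by
    by_contra! hcon
    apply hw
    rw [hPT]
    simpa [halfSpace] using hcon
  obtain ⟨f, hf, hfw⟩ := hwT
  refine ⟨f, ⟨?_, ?_, ?_⟩, hfw⟩
  · rintro rfl
    simp at hfw
  · rw [hPT]
    exact Set.biInter_subset_of_mem (t := fun g : Γ => halfSpace x (g.1 x)) hf
  · obtain ⟨p, hp, hpo⟩ := hess f hf
    -- The function `cosh d(x, ·) - cosh d(f x, ·)` equals `a` at `p` and `-b` at `x`, so it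
    -- vanishes at the combination with weight `a` on `x` and `b` on `p`.
    have ha : 0 < Real.cosh (dist x p) - Real.cosh (dist (f.1 x) p) :=
      sub_pos.2 (dist_lt_iff_cosh.1 hp)
    have hb : 0 < Real.cosh (dist (f.1 x) x) - 1 := sub_pos.2 (hpos f hf)
    obtain ⟨m, hm⟩ := exists_proportional_combination x p ha hb
    set a := Real.cosh (dist x p) - Real.cosh (dist (f.1 x) p) with ha'
    set b := Real.cosh (dist (f.1 x) x) - 1 with hb'
    have hN : 0 < √(a ^ 2 + b ^ 2 + 2 * a * b * Real.cosh (dist x p)) := by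
      have := Real.cosh_pos (dist x p)
      positivity
    have hmx := hm x
    rw [dist_self, Real.cosh_zero] at hmx
    have hfm : dist x m = dist (f.1 x) m := by
      have : Real.cosh (dist x m) = Real.cosh (dist (f.1 x) m) := by
        apply mul_left_cancel₀ hN.ne'
        rw [hmx, hm (f.1 x), ha', hb']
        ring
      exact le_antisymm (dist_le_iff_cosh.2 this.le) (dist_le_iff_cosh.2 this.ge)
    -- The other inequalities are weak at `p` but strict at `x`, hence strict at `m` and, by
    -- continuity, near `m`.
    have hgm : ∀ g ∈ T, g ≠ f → dist x m < dist (g.1 x) m := by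
      intro g hg hgf
      rw [dist_lt_iff_cosh]
      apply lt_of_mul_lt_mul_left _ hN.le
      rw [hmx, hm (g.1 x)]
      have h1 := mul_lt_mul_of_pos_left (hpos g hg) ha
      have h2 := mul_le_mul_of_nonneg_left (dist_le_iff_cosh.1 (hpo g hg hgf)) hb.le
      linarith
    have hnear : ∀ᶠ v in nhds m, ∀ g ∈ T, g ≠ f → dist x v < dist (g.1 x) v := by
      rw [Filter.eventually_all_finset]
      intro g hg
      by_cases hgf : g = f
      · simp [hgf]
      · have : Continuous fun v => dist x v := by fun_prop
        have h' : Continuous fun v => dist (g.1 x) v := by fun_prop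
        filter_upwards [this.continuousAt.eventually_lt h'.continuousAt (hgm g hg hgf)]
          with v hv _ using hv
    obtain ⟨δ, hδ, hball⟩ := Metric.eventually_nhds_iff_ball.1 hnear
    refine ⟨m, hfm, δ, hδ, ?_⟩
    rintro v ⟨hv, hvf⟩
    rw [hPT]
    simp only [Set.mem_iInter]
    intro g hg
    by_cases hgf : g = f
    · subst hgf
      exact le_of_eq hvf
    · exact (hball v hv g hg hgf).le

/-! ### Volume and compactness of balls -/

/-- Every metric ball of a given radius has volume bounded below, even after shrinking it to a
measurable subset. -/
theorem exists_measurable_subset_ball {r : ℝ} (hr : 0 < r) :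
    ∃ ε : ℝ, 0 < ε ∧ ∀ m : Hyp3, ∃ E : Set (ℂ × ℝ), MeasurableSet E ∧
      E ⊆ coords '' ball m r ∧
      ENNReal.ofReal ε ≤ ∫⁻ p in E, ENNReal.ofReal (1 / p.2 ^ 3) := by
  have hc : 0 < Real.cosh r - 1 := sub_pos.2 (Real.one_lt_cosh.2 hr.ne')
  obtain ⟨δ, hδ, hδ2, hδr⟩ : ∃ δ : ℝ, 0 < δ ∧ δ ≤ 1 / 2 ∧ 2 * δ ^ 2 ≤ Real.cosh r - 1 := by
    refine ⟨min (1 / 2) (Real.cosh r - 1), by positivity, min_le_left _ _, ?_⟩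
    have h1 := min_le_left (1 / 2) (Real.cosh r - 1)
    have h2 := min_le_right (1 / 2) (Real.cosh r - 1)
    have h3 : 0 < min (1 / 2) (Real.cosh r - 1) := by positivity
    nlinarith
  refine ⟨Real.pi * δ ^ 3 / 4, by positivity, fun m => ?_⟩
  have hm := m.t_pos
  have hδm : 0 < δ * m.t := by positivity
  have hbox : ∀ q ∈ ball m.coords (δ * m.t), ‖q.1 - m.z‖ < δ * m.t ∧ |q.2 - m.t| < δ * m.t := by
    intro q hq
    rw [mem_ball, Prod.dist_eq, max_lt_iff, dist_eq_norm, Real.dist_eq] at hq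
    exact hq
  have hbound : ∀ q ∈ ball m.coords (δ * m.t), m.t / 2 < q.2 ∧ q.2 < 2 * m.t := by
    intro q hq
    have := abs_lt.1 (hbox q hq).2
    constructor <;> nlinarith
  -- A coordinate cylinder scaled by the height `m.t`: the density is at least `1 / (2 * m.t) ^ 3`
  -- there, so `m.t` cancels from the bound.
  refine ⟨ball m.coords (δ * m.t), measurableSet_ball, ?_, ?_⟩
  · intro q hq
    obtain ⟨h1, h2⟩ := hbox q hq
    have h3 := (hbound q hq).1
    have hq0 : 0 < q.2 := by linarith
    refine ⟨⟨q.1, q.2, hq0⟩, ?_, rfl⟩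
    rw [mem_ball, ← abs_of_nonneg (dist_nonneg (x := (⟨q.1, q.2, hq0⟩ : Hyp3)) (y := m)),
      ← abs_of_pos hr, ← Real.cosh_lt_cosh, cosh_dist]
    have e1 : ‖q.1 - m.z‖ ^ 2 < (δ * m.t) ^ 2 := by gcongr
    have e2 : (q.2 - m.t) ^ 2 < (δ * m.t) ^ 2 := by
      rw [sq_lt_sq, abs_of_pos hδm]; exact h2
    have : (‖q.1 - m.z‖ ^ 2 + (q.2 - m.t) ^ 2) / (2 * q.2 * m.t) < 2 * δ ^ 2 := by
      rw [div_lt_iff₀ (by positivity)]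
      have : δ ^ 2 * (m.t * (m.t / 2)) ≤ δ ^ 2 * (m.t * q.2) := by gcongr
      nlinarith
    simp only
    linarith
  · calc ENNReal.ofReal (Real.pi * δ ^ 3 / 4)
        = ENNReal.ofReal (1 / (2 * m.t) ^ 3) * MeasureTheory.volume (ball m.coords (δ * m.t)) := by
          rw [coords, ← ball_prod_same, MeasureTheory.Measure.volume_eq_prod,
            MeasureTheory.Measure.prod_prod, Complex.volume_ball, Real.volume_ball,
            ← ENNReal.ofReal_pow hδm.le]
          rw [show (NNReal.pi : ENNReal) = ENNReal.ofReal Real.pi by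
            rw [← NNReal.coe_real_pi, ENNReal.ofReal_coe_nnreal]]
          rw [← ENNReal.ofReal_mul (by positivity), ← ENNReal.ofReal_mul (by positivity),
            ← ENNReal.ofReal_mul (by positivity)]
          congr 1
          field_simp
          ring
      _ ≤ _ := by
          rw [← MeasureTheory.setLIntegral_const]
          refine MeasureTheory.setLIntegral_mono' measurableSet_ball fun q hq => ?_
          obtain ⟨h1, h2⟩ := hbound q hq
          have hq0 : 0 < q.2 := by linarith
          gcongr

/-- Any ball is contained in a compact set. -/
theorem exists_isCompact_ball_subset (x : Hyp3) (R : ℝ) : ∃ K, IsCompact K ∧ ball x R ⊆ K := by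
  have hx := x.t_pos
  set C := Real.cosh R
  have hC : 0 < C := Real.cosh_pos R
  set c := x.t / (2 * C)
  have hc : 0 < c := by positivity
  -- Truncating heights at `c` gives a map defined on all of `ℂ × ℝ`; points of the ball have height
  -- at least `c`, so they are unaffected.
  let φ : ℂ × ℝ → Hyp3 := fun q => ⟨q.1, max q.2 c, lt_max_of_lt_right hc⟩
  have hφ : Continuous φ := by
    rw [continuous_iff_continuousAt]
    intro q
    rw [ContinuousAt, tendsto_iff_dist_tendsto_zero]
    have hcont : Continuous fun v => dist (φ v) (φ q) := by
      simp only [dist_eq, toEuclidean, φ]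
      refine continuous_const.mul (Real.continuous_arsinh.comp (Continuous.div ?_ ?_ ?_))
      · fun_prop
      · fun_prop
      · intro v
        have h1 : 0 < max v.2 c := lt_max_of_lt_right hc
        have h2 : 0 < max q.2 c := lt_max_of_lt_right hc
        positivity
    have := hcont.tendsto q
    rwa [dist_self] at this
  refine ⟨φ '' (closedBall x.z (2 * C * x.t) ×ˢ Icc c (2 * C * x.t)),
    ((isCompact_closedBall _ _).prod isCompact_Icc).image hφ, fun p hp => ?_⟩
  have hpt := p.t_pos
  have h := cosh_dist_lt_cosh (mem_ball.1 hp)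
  rw [cosh_dist_eq, div_lt_iff₀ (by positivity)] at h
  have hn := sq_nonneg ‖p.z - x.z‖
  have h1 : p.t ≤ 2 * C * x.t := by
    by_contra! hlt
    nlinarith
  have h2 : c ≤ p.t := by
    rw [div_le_iff₀ (by positivity)]
    by_contra! hlt
    nlinarith
  refine ⟨p.coords, ⟨?_, h2, h1⟩, Hyp3.ext rfl (max_eq_left h2)⟩
  rw [mem_closedBall, dist_eq_norm]
  refine le_of_sq_le_sq ?_ (by positivity)
  have : 2 * C * x.t * p.t ≤ 2 * C * x.t * (2 * C * x.t) := by gcongr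
  simp only [coords]
  nlinarith [sq_nonneg p.t, sq_nonneg x.t]

/-! ### Orbit points and the volume gap -/

theorem finite_orbit_ball {Γ : Subgroup (Hyp3 ≃ᵢ Hyp3)} (hΓ : IsManifoldGroup Γ) (x : Hyp3)
    {R : ℝ} (hR : 0 < R) : {g : Γ | g.1 x ∈ ball x R}.Finite := by
  obtain ⟨K, hK, hsub⟩ := exists_isCompact_ball_subset x R
  refine Set.Finite.of_finite_image (f := Subtype.val)
    ((hΓ.properlyDiscontinuous K hK).subset ?_) Subtype.val_injective.injOn
  rintro _ ⟨g, hg, rfl⟩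
  exact ⟨g.2, g.1 x, ⟨x, hsub (mem_ball_self hR), rfl⟩, hsub hg⟩

theorem le_dist_of_ball_subset {Γ : Subgroup (Hyp3 ≃ᵢ Hyp3)} (hΓ : IsManifoldGroup Γ) {x : Hyp3}
    {ρ : ℝ} (h : ball x ρ ⊆ dirichletDomain Γ x) {g : Hyp3 ≃ᵢ Hyp3} (hg : g ∈ Γ) (hg1 : g ≠ 1) :
    ρ ≤ dist (g x) x := by
  by_contra! hlt
  have := h (mem_ball.2 hlt) g hg hg1
  rw [dist_self] at this
  exact hg1 (hΓ.free g hg x (dist_le_zero.1 this |>.symm))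

theorem cosh_le_exp_mul_cosh {u v r : ℝ} (hu : 0 ≤ u) (h : u ≤ v + r) (hr : 0 ≤ r) :
    Real.cosh u ≤ Real.exp r * Real.cosh v := by
  have h1 : Real.cosh u ≤ Real.cosh (v + r) := by
    rw [Real.cosh_le_cosh, abs_of_nonneg hu]
    exact h.trans (le_abs_self _)
  have h2 : Real.exp (-r) * Real.exp (-v) ≤ Real.exp r * Real.exp (-v) := by
    gcongr
    linarith
  refine h1.trans ?_
  rw [Real.cosh_eq, Real.cosh_eq, neg_add, Real.exp_add, Real.exp_add]
  linarith

/-- If `y` is at bounded distance from `x`, some ball of definite size close to `y` lies in every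
half-space that contains `y` and is bounded by the bisector of `x` and a point not too close
to `x`. -/
theorem exists_radius_ball_subset (R : ℝ) {ρ : ℝ} (hρ : 0 < ρ) :
    ∃ r > 0, ∀ x y : Hyp3, dist x y < R → ∃ m : Hyp3, ball m r ⊆ ball y (ρ / 2) ∧
      ∀ z : Hyp3, ρ ≤ dist z x → dist x y ≤ dist z y → ball m r ⊆ halfSpace x z := by
  set C := Real.cosh R
  have hC1 : 1 ≤ C := Real.one_le_cosh R
  have hη : 0 < Real.cosh (ρ / 4) - 1 := sub_pos.2 (Real.one_lt_cosh.2 (by positivity))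
  have hκ : 0 < Real.cosh ρ - 1 := sub_pos.2 (Real.one_lt_cosh.2 hρ.ne')
  -- The weight of `x` in `α x + y`, chosen so that `α * C + 1 = cosh (ρ / 4)`, which keeps `m`
  -- within `ρ / 4` of `y`.
  set α := (Real.cosh (ρ / 4) - 1) / C
  have hα0 : 0 < α := by positivity
  -- Lower bound for `cosh d(z, m) / cosh d(x, m)`. Passing from `m` to a point of the ball costs a
  -- factor `exp r` in each of the two terms, hence the condition `exp (2r) ≤ K`.
  set K := 1 + α * (Real.cosh ρ - 1) / (α + C) with hK
  have hK1 : 1 < K := by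
    have : 0 < α * (Real.cosh ρ - 1) / (α + C) := by positivity
    linarith
  refine ⟨min (ρ / 4) (Real.log K / 2), lt_min (by positivity)
    (half_pos (Real.log_pos hK1)), fun x y hxy => ?_⟩
  set r := min (ρ / 4) (Real.log K / 2)
  have hr0 : 0 < r := lt_min (by positivity) (half_pos (Real.log_pos hK1))
  have hr1 : r ≤ ρ / 4 := min_le_left _ _
  have hr2 : Real.exp (r + r) ≤ K := by
    rw [← Real.le_log_iff_exp_le (by linarith)]
    linarith [min_le_right (ρ / 4) (Real.log K / 2)]
  have hxyC := cosh_dist_lt_cosh hxy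
  have hxy1 := Real.one_le_cosh (dist x y)
  obtain ⟨m, hm⟩ := exists_proportional_combination x y hα0 one_pos
  set N := √(α ^ 2 + 1 ^ 2 + 2 * α * 1 * Real.cosh (dist x y))
  have hN1 : 1 ≤ N := Real.one_le_sqrt.2 (by nlinarith)
  have hmx := hm x
  have hmy := hm y
  rw [dist_self, Real.cosh_zero] at hmx hmy
  rw [dist_comm y x] at hmy
  have hym : dist y m ≤ ρ / 4 := by
    rw [← abs_of_nonneg (dist_nonneg (x := y) (y := m)), ← abs_of_pos (by positivity : 0 < ρ / 4),
      ← Real.cosh_le_cosh]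
    have h1 : Real.cosh (dist y m) ≤ N * Real.cosh (dist y m) :=
      le_mul_of_one_le_left (Real.cosh_pos _).le hN1
    have h2 : α * Real.cosh (dist x y) ≤ α * C := by gcongr
    have h3 : α * C = Real.cosh (ρ / 4) - 1 := div_mul_cancel₀ _ (by positivity)
    linarith
  refine ⟨m, ball_subset_ball' (by rw [dist_comm] at hym; linarith), fun z hzx hzy w hw => ?_⟩
  have hmw : dist w m < r := hw
  have hA := cosh_le_exp_mul_cosh (u := dist z m) (v := dist z w) (r := r) dist_nonneg
    (by linarith [dist_triangle z w m]) hr0.le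
  have hB := cosh_le_exp_mul_cosh (u := dist x w) (v := dist x m) (r := r) dist_nonneg
    (by linarith [dist_triangle x m w, dist_comm m w]) hr0.le
  have hzx' : Real.cosh ρ ≤ Real.cosh (dist z x) := by
    rwa [Real.cosh_le_cosh, abs_of_pos hρ, abs_of_nonneg dist_nonneg]
  have hmz := hm z
  have hkey : K * Real.cosh (dist x m) ≤ Real.cosh (dist z m) := by
    apply le_of_mul_le_mul_left _ (by linarith : 0 < N)
    have h1 : N * Real.cosh (dist x m) ≤ α + C := by linarith
    have h2 : α * (Real.cosh ρ - 1) / (α + C) * (N * Real.cosh (dist x m)) ≤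
        α * (Real.cosh ρ - 1) := by
      rw [div_mul_eq_mul_div, div_le_iff₀ (by positivity)]
      gcongr
    have h3 := dist_le_iff_cosh.1 hzy
    have h4 : α * (Real.cosh ρ - 1) ≤ α * (Real.cosh (dist z x) - 1) := by gcongr
    calc N * (K * Real.cosh (dist x m)) = N * Real.cosh (dist x m) +
          α * (Real.cosh ρ - 1) / (α + C) * (N * Real.cosh (dist x m)) := by rw [hK]; ring
      _ ≤ N * Real.cosh (dist z m) := by rw [hmz, ← sub_nonneg] at *; linarith
  change dist x w ≤ dist z w
  rw [dist_le_iff_cosh]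
  apply le_of_mul_le_mul_left _ (Real.exp_pos r)
  calc Real.exp r * Real.cosh (dist x w) ≤ Real.exp r * (Real.exp r * Real.cosh (dist x m)) := by
        gcongr
    _ = Real.exp (r + r) * Real.cosh (dist x m) := by rw [Real.exp_add]; ring
    _ ≤ K * Real.cosh (dist x m) := by gcongr
    _ ≤ Real.cosh (dist z m) := hkey
    _ ≤ _ := hA

/-- A polyhedron whose volume is close to that of the Dirichlet domain contains no orbit point
other than its centre in a given ball. -/
theorem exists_volume_gap (R : ℝ) {ρ : ℝ} (hρ : 0 < ρ) :
    ∃ ε : ℝ, 0 < ε ∧ ∀ (Γ : Subgroup (Hyp3 ≃ᵢ Hyp3)) (x : Hyp3) (P : Set Hyp3),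
      IsManifoldGroup Γ → hypVolume (dirichletDomain Γ x) < ⊤ →
      ball x ρ ⊆ dirichletDomain Γ x →
      (∃ S : Finset Γ, P = ⋂ g ∈ S, halfSpace x (g.1 x)) →
      hypVolume P - hypVolume (dirichletDomain Γ x) < ENNReal.ofReal ε →
      ∀ g ∈ Γ, g ≠ 1 → dist x (g x) < R → g x ∉ P := by
  obtain ⟨r, hr, hball⟩ := exists_radius_ball_subset R hρ
  obtain ⟨ε, hε, hvol⟩ := exists_measurable_subset_ball hr
  refine ⟨ε, hε, ?_⟩
  rintro Γ x P hΓ hfin hρD ⟨S, rfl⟩ hlt g hg hg1 hgR hgP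
  obtain ⟨m, hmy, hmz⟩ := hball x (g x) hgR
  obtain ⟨E, hE, hEm, hEε⟩ := hvol m
  have hone : ∀ h : Γ, h = 1 → halfSpace x (h.1 x) = Set.univ := by
    rintro _ rfl
    simp [halfSpace]
  have hmP : ball m r ⊆ ⋂ g ∈ S, halfSpace x (g.1 x) := by
    refine Set.subset_iInter₂ fun h hh => ?_
    by_cases h1 : h = 1
    · simp [hone h h1]
    · exact hmz _ (le_dist_of_ball_subset hΓ hρD h.2 (by simpa using h1))
        (Set.mem_iInter₂.1 hgP h hh)
  have hDP : dirichletDomain Γ x ⊆ ⋂ g ∈ S, halfSpace x (g.1 x) := by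
    refine Set.subset_iInter₂ fun h hh => ?_
    by_cases h1 : h = 1
    · simp [hone h h1]
    · exact fun w hw => hw h.1 h.2 (by simpa using h1)
  have hcoords : Function.Injective coords := fun p q h =>
    Hyp3.ext (congrArg Prod.fst h) (congrArg Prod.snd h)
  -- A point of `D` within `ρ / 2` of `g x` would also be within `ρ / 2` of `x`, against `d(g x, x)
  -- ≥ ρ`.
  have hdisj : Disjoint (coords '' dirichletDomain Γ x) E := by
    refine Disjoint.mono_right hEm ((Set.disjoint_image_iff hcoords).2 ?_)
    rw [Set.disjoint_left]
    intro w hwD hwm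
    have h1 : dist w (g x) < ρ / 2 := hmy hwm
    have h2 := hwD g hg hg1
    have h3 := le_dist_of_ball_subset hΓ hρD hg hg1
    linarith [dist_triangle (g x) w x, dist_comm (g x) w, dist_comm x w]
  -- Finiteness of `vol(D)` makes the subtraction in `ℝ≥0∞` meaningful; only `E` has to be
  -- measurable for the two integrals to add.
  refine hlt.not_ge (hEε.trans (ENNReal.le_sub_of_add_le_left hfin.ne ?_))
  rw [hypVolume, ← MeasureTheory.lintegral_union hE hdisj]
  exact MeasureTheory.lintegral_mono_set
    (Set.union_subset (Set.image_mono hDP) (hEm.trans (Set.image_mono hmP)))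

/-- If each nontrivial orbit point in the ball lies on the far side of some face of `P`, then the
Cayley graph of the face-pairings is connected inside the ball. -/
theorem connectedInBall_cayleyGraph {Γ : Subgroup (Hyp3 ≃ᵢ Hyp3)} (hΓ : IsManifoldGroup Γ)
    {x : Hyp3} {P : Set Hyp3} {R : ℝ} (hR : 0 < R)
    (h : ∀ g : Γ, g ≠ 1 → dist x (g.1 x) < R →
      ∃ f ∈ facePairings Γ x P, dist (f.1 x) (g.1 x) < dist x (g.1 x)) :
    ConnectedInBall (cayleyGraph Γ x P) x R := by
  have hfin := finite_orbit_ball hΓ x hR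
  let V := {g : Γ | g.1 x ∈ ball x R}
  have hfinV : Finite V := hfin
  let o : V := ⟨1, by simpa [V] using hR⟩
  have hreach : ∀ v : V, ((cayleyGraph Γ x P).induce V).Reachable v o := by
    intro v
    induction v using (Finite.wellFounded_of_trans_of_irrefl
      (InvImage (· < ·) fun v : V => dist (v.1.1 x) x)).induction with
    | _ v ih =>
      obtain ⟨g, hg⟩ := v
      by_cases hg1 : g = 1
      · subst hg1; exact .refl _
      have hinv : ∀ u : Hyp3, dist u (g⁻¹.1 x) = dist (g.1 u) x := by
        intro u
        rw [← g.1.isometry.dist_eq u]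
        congr 1
        exact g.1.apply_symm_apply x
      -- Edges multiply on the right, so the face is sought for `g⁻¹ x`, and the isometry `g`
      -- carries the inequality to one between `g f x` and `g x`.
      obtain ⟨f, hf, hlt⟩ := h g⁻¹ (inv_ne_one.2 hg1) (by rw [hinv]; exact hg)
      rw [hinv, hinv] at hlt
      have hlt' : dist ((g * f).1 x) x < dist (g.1 x) x := hlt
      have hgf : g * f ∈ V := hlt'.trans hg
      have hadj : ((cayleyGraph Γ x P).induce V).Adj ⟨g, hg⟩ ⟨g * f, hgf⟩ := by
        refine (SimpleGraph.mulCayley_adj' _ _ _).2 ⟨fun he => hf.1 ?_, f, hf, Or.inl rfl⟩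
        exact mul_eq_left.1 he.symm
      exact hadj.reachable.trans (ih ⟨g * f, hgf⟩ hlt')
  exact { preconnected := fun u v => (hreach u).trans (hreach v).symm, nonempty := ⟨o⟩ }

end Hyp3

theorem mainTheorem2 (R ρ : ℝ) (hR : 0 < R) (hρ : 0 < ρ) :
    ∃ ε : ℝ, 0 < ε ∧
      ∀ (Γ : Subgroup (Hyp3 ≃ᵢ Hyp3)) (x : Hyp3) (D' : Set Hyp3),
        Hyp3.IsManifoldGroup Γ →
        Hyp3.hypVolume (Hyp3.dirichletDomain Γ x) < ⊤ →
        Metric.ball x ρ ⊆ Hyp3.dirichletDomain Γ x →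
        Hyp3.IsApproxDirichletDomain Γ x D' →
        Hyp3.hypVolume D' - Hyp3.hypVolume (Hyp3.dirichletDomain Γ x) < ENNReal.ofReal ε →
        Hyp3.ConnectedInBall (Hyp3.cayleyGraph Γ x D') x R := by
  obtain ⟨ε, hε, hgap⟩ := Hyp3.exists_volume_gap R hρ
  refine ⟨ε, hε, fun Γ x D' hΓ hfin hD hD' hlt => ?_⟩
  obtain ⟨S, hS⟩ := hD'.1
  exact Hyp3.connectedInBall_cayleyGraph hΓ hR fun g hg hgR =>
    Hyp3.exists_facePairing_dist_lt hS
      (hgap Γ x D' hΓ hfin hD hD'.1 hlt g.1 g.2 (by simpa using hg) hgR)
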